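/- Let $K$ be a field of characteristic $0$ (for example $K=\mathbb{C}$), let $R=K[x,y,z]$, let $k\ge 1$ be an integer and let $l=\binom{k+2}{3}$. For an ideal $J\subseteq R$ of colength $l$ (that is, $\dim_K R/J=l$) let $T(J)=\dim_K \operatorname{Hom}_R(J,R/J)$ be the dimension of the tangent space to $\mathrm{Hilb}^l(\mathbb{A}^3)$ at the point $[J]$. Let $I\subseteq R$ be a Borel-fixed ideal of colength $l$: $I$ is a monomial ideal such that for every minimal monomial generator $g$ of $I$, if $z\mid g$ then $\frac{xg}{z},\frac{yg}{z}\in I$, and if $y\mid g$ then $\frac{xg}{y}\in I$. Suppose that $[I]$ has the maximal singularity, i.e. $T(I)\ge T(J)$ for every ideal $J\subseteq R$ of colength $l$. Write $x^{m_1},y^{m_2},z^{m_3}$ for the pure powers of the variables among the minimal monomial generators of $I$. Then $m_1=k$, and $m_1$ is the smallest of the pure exponents $m_1,m_2,m_3$. -/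

import Mathlib

open MvPolynomial

/-- The polynomial ring `K[x, y, z]`, with `x = X 0`, `y = X 1`, `z = X 2`. -/
abbrev R₃ (K : Type*) [Field K] : Type _ := MvPolynomial (Fin 3) K

/-- `I` is a zero-dimensional ideal of colength `l`, that is, a point of `Hilb^l(𝔸³)`:
the `K`-vector space `K[x,y,z] / I` has finite dimension `l`. -/
structure IsHilbPoint {K : Type*} [Field K] (l : ℕ) (I : Ideal (R₃ K)) : Prop where
  finite : Module.Finite K (R₃ K ⧸ I)
  colength : Module.finrank K (R₃ K ⧸ I) = l

/-- `T(I)`: the dimension over `K` of the tangent space `Hom_R(I, R/I)` to the Hilbert scheme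
at the point `[I]`. (For `I` of finite colength this space is finite-dimensional, as `I` is
finitely generated.) -/
noncomputable def tangentDim {K : Type*} [Field K] (I : Ideal (R₃ K)) : ℕ :=
  Module.finrank K (I →ₗ[R₃ K] (R₃ K ⧸ I))

/-- `[I]` is a point of `Hilb^l(𝔸³)` having the maximal singularity: `T(J) ≤ T(I)` for every
point `[J]` (every ideal `J` of colength `l`, not only the monomial ones). -/
structure HasMaximalSingularity {K : Type*} [Field K] (l : ℕ) (I : Ideal (R₃ K)) : Prop where
  isHilbPoint : IsHilbPoint l I
  tangentDim_le : ∀ J : Ideal (R₃ K), IsHilbPoint l J → tangentDim J ≤ tangentDim I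

/-- `I` is generated by monomials. -/
def IsMonomialIdeal {K : Type*} [Field K] (I : Ideal (R₃ K)) : Prop :=
  ∃ S : Set (Fin 3 →₀ ℕ), I = Ideal.span ((fun g => monomial g (1 : K)) '' S)

/-- `g` is the exponent vector of a minimal monomial generator of `I`: the monomial with
exponent `g` lies in `I`, and `g` is minimal with this property for the componentwise order
(divisibility of monomials). -/
def IsMinimalGenerator {K : Type*} [Field K] (I : Ideal (R₃ K)) (g : Fin 3 →₀ ℕ) : Prop :=
  Minimal (fun a => monomial a (1 : K) ∈ I) g

/-- `I` is Borel-fixed: it is a monomial ideal, and whenever a variable `x_j` divides a minimal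
monomial generator `g`, then `x_i * g / x_j ∈ I` for all `i < j`. That is:
if `z ∣ g` then `x g / z ∈ I` and `y g / z ∈ I`; if `y ∣ g` then `x g / y ∈ I`. -/
structure IsBorelFixed {K : Type*} [Field K] (I : Ideal (R₃ K)) : Prop where
  isMonomialIdeal : IsMonomialIdeal I
  exchange : ∀ g : Fin 3 →₀ ℕ, IsMinimalGenerator I g → ∀ i j : Fin 3, i < j → 1 ≤ g j →
    monomial (g - Finsupp.single j 1 + Finsupp.single i 1) (1 : K) ∈ I

/-- `m` is the pure exponent of `I` in the variable `x_i`: the power `x_i ^ m` is one of the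
minimal monomial generators of `I`. -/
def IsPureExponent {K : Type*} [Field K] (I : Ideal (R₃ K)) (i : Fin 3) (m : ℕ) : Prop :=
  IsMinimalGenerator I (Finsupp.single i m)

/-! Let `E` be the set of exponents outside `I`, `l = E.card`, and `m` the least exponent with `x ^
m ∈ I`. Two bounds are compared. Upper bound (`IsComplementIdeal.tangentDim_le`): `T(I) ≤ l + 2 s`,
where `s` counts `socleColumnPairs E`. Commuting triples of matrices are the critical points of `tr
(X₀ (X₁ X₂ - X₂ X₁))`. The tangent space, enlarged by `(l - 1) l` free parameters, embeds in the
radical of the Hessian of this function at the triple of multiplication matrices of `R/I`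
(`linearityDefect`). The function has weight one in the `z`-grading, so the Hessian pairs entries of
negative `z`-degree only with entries of nonnegative `z`-degree. The radical is thus known once its
negative half is (`finrank_ker_hessianForm`), and the exchange property bounds that half
(`finrank_ker_inf_le`). A count (`card_socleColumnPairs_add_le`) gives `s ≤ m l - ∑_{q < m} C(q+2,
3)`. For `m < k` this makes `l + 2 s` smaller than `C(k+2, 2) C(k+1, 2)` (`choose_three_bound_lt`),
a lower bound for the tangent dimension at the `k`-th power of the maximal ideal, which also has
colength `l`. Hence `m ≥ k`. If `m > k`, the exchange property puts all monomials of degree at most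
`k` in `E`, which is more than `l`. So `m = k`, and exchange shows that no smaller power of `y` or
`z` lies in `I`. -/

/-! ### Linear algebra: radicals of symmetric forms with two isotropic halves. -/

/-- The vectors of `J → K` whose support is contained in `{j | p j}`. -/
def coordSubspace (K : Type*) [Field K] {J : Type*} (p : J → Prop) : Submodule K (J → K) where
  carrier := {v | ∀ j, ¬ p j → v j = 0}
  add_mem' := fun {a b} ha hb j hj => by simp [ha j hj, hb j hj]
  zero_mem' := fun _ _ => rfl
  smul_mem' := fun c v hv j hj => by simp [hv j hj]

theorem finrank_coordSubspace (K : Type*) [Field K] {J : Type*} [Fintype J] (p : J → Prop)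
    [DecidablePred p] :
    Module.finrank K (coordSubspace K p) = Fintype.card {j // p j} := by
  classical
  let e : coordSubspace K p ≃ₗ[K] ({j // p j} → K) :=
    { toFun := fun v j => v.1 j.1
      map_add' := fun _ _ => rfl
      map_smul' := fun _ _ => rfl
      invFun := fun w => ⟨fun j => if h : p j then w ⟨j, h⟩ else 0, fun j hj => by simp [hj]⟩
      left_inv := fun v => by
        ext j
        by_cases h : p j
        · simp [h]
        · simp [h, v.2 j h]
      right_inv := fun w => by
        ext j
        simp [j.2] }
  rw [e.finrank_eq, Module.finrank_fintype_fun_eq_card]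

theorem isCompl_coordSubspace (K : Type*) [Field K] {J : Type*} (p : J → Prop) :
    IsCompl (coordSubspace K p) (coordSubspace K fun j => ¬ p j) := by
  classical
  rw [isCompl_iff, Submodule.disjoint_def, codisjoint_iff_le_sup]
  constructor
  · intro v h1 h2
    ext j
    by_cases h : p j
    · exact h2 j (not_not.mpr h)
    · exact h1 j h
  · intro v _
    rw [Submodule.mem_sup]
    refine ⟨fun j => if p j then v j else 0, fun j hj => by simp [hj],
      fun j => if p j then 0 else v j, fun j hj => by simp [not_not.mp hj], ?_⟩
    ext j
    by_cases h : p j <;> simp [h]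

/-- The left and the right rank of a bilinear pairing of finite-dimensional spaces agree. -/
theorem finrank_range_flip {K U V : Type*} [Field K] [AddCommGroup U] [Module K U]
    [AddCommGroup V] [Module K V] [FiniteDimensional K U] [FiniteDimensional K V]
    (b : U →ₗ[K] V →ₗ[K] K) :
    Module.finrank K (LinearMap.range b.flip) = Module.finrank K (LinearMap.range b) := by
  have h : b.flip = b.dualMap ∘ₗ (Module.evalEquiv K V).toLinearMap := by
    ext v u
    simp
  rw [h, LinearMap.range_comp, LinearEquiv.range, Submodule.map_top,
    LinearMap.finrank_range_dualMap_eq_finrank_range]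

/-- The radical of a symmetric form for which two complementary subspaces `N` and `P` are
isotropic, in terms of its part in `N`. -/
theorem finrank_ker_of_isotropic {K W : Type*} [Field K] [AddCommGroup W] [Module K W]
    [FiniteDimensional K W] (B : W →ₗ[K] W →ₗ[K] K) (hB : ∀ x y, B x y = B y x)
    (N P : Submodule K W) (hNP : IsCompl N P) (hN : ∀ x ∈ N, ∀ y ∈ N, B x y = 0)
    (hP : ∀ x ∈ P, ∀ y ∈ P, B x y = 0) :
    Module.finrank K (LinearMap.ker B) + Module.finrank K N =
      2 * Module.finrank K ↥(LinearMap.ker B ⊓ N) + Module.finrank K P := by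
  -- In block form `B` is antidiagonal with blocks `b` and its transpose, so its kernel is the
  -- direct sum of the left and right kernels of `b`. These have the same corank, hence their
  -- dimensions differ by `dim P - dim N`.
  let b : N →ₗ[K] P →ₗ[K] K := B.domRestrict₁₂ N P
  have hb : ∀ x y, b x y = B x.1 y.1 := fun _ _ => rfl
  have split : ∀ w : W, ∃ x ∈ N, ∃ y ∈ P, x + y = w := fun w => by
    have : w ∈ N ⊔ P := by rw [hNP.sup_eq_top]; trivial
    exact Submodule.mem_sup.mp this
  have k1 : LinearMap.ker B ⊓ N = (LinearMap.ker b).map N.subtype := by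
    ext w
    simp only [Submodule.mem_inf, LinearMap.mem_ker, Submodule.mem_map, Submodule.subtype_apply]
    constructor
    · rintro ⟨h1, h2⟩
      exact ⟨⟨w, h2⟩, by ext y; simp [hb, h1], rfl⟩
    · rintro ⟨x, hx, rfl⟩
      refine ⟨?_, x.2⟩
      ext w
      obtain ⟨u, hu, v, hv, rfl⟩ := split w
      have := LinearMap.congr_fun hx ⟨v, hv⟩
      rw [hb] at this
      simp_all
  have k2 : LinearMap.ker B ⊓ P = (LinearMap.ker b.flip).map P.subtype := by
    ext w
    simp only [Submodule.mem_inf, LinearMap.mem_ker, Submodule.mem_map, Submodule.subtype_apply]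
    constructor
    · rintro ⟨h1, h2⟩
      exact ⟨⟨w, h2⟩, by ext y; simp [hb, hB y.1 w, h1], rfl⟩
    · rintro ⟨x, hx, rfl⟩
      refine ⟨?_, x.2⟩
      ext w
      obtain ⟨u, hu, v, hv, rfl⟩ := split w
      have := LinearMap.congr_fun hx ⟨u, hu⟩
      rw [LinearMap.flip_apply, hb, hB] at this
      simp_all
  have k3 : LinearMap.ker B = (LinearMap.ker B ⊓ N) ⊔ (LinearMap.ker B ⊓ P) := by
    refine le_antisymm (fun w hw => ?_) (sup_le inf_le_left inf_le_left)
    obtain ⟨u, hu, v, hv, rfl⟩ := split w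
    rw [LinearMap.mem_ker] at hw
    have hu' : B u = 0 := by
      ext w
      obtain ⟨x, hx, y, hy, rfl⟩ := split w
      have h1 := LinearMap.congr_fun hw y
      simp only [map_add, LinearMap.add_apply, LinearMap.zero_apply, hP v hv y hy, add_zero,
        hN u hu x hx, zero_add] at h1 ⊢
      exact h1
    have hv' : B v = 0 := by simpa [hu'] using hw
    exact Submodule.add_mem_sup ⟨hu', hu⟩ ⟨hv', hv⟩
  have k4 : (LinearMap.ker B ⊓ N) ⊓ (LinearMap.ker B ⊓ P) = ⊥ := by
    rw [eq_bot_iff, ← hNP.inf_eq_bot]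
    exact inf_le_inf inf_le_right inf_le_right
  have h1 := Submodule.finrank_sup_add_finrank_inf_eq (LinearMap.ker B ⊓ N) (LinearMap.ker B ⊓ P)
  rw [← k3, k4, finrank_bot] at h1
  have h2 : Module.finrank K ↥(LinearMap.ker B ⊓ N) = Module.finrank K (LinearMap.ker b) := by
    rw [k1, Submodule.finrank_map_subtype_eq]
  have h3 : Module.finrank K ↥(LinearMap.ker B ⊓ P) = Module.finrank K (LinearMap.ker b.flip) := by
    rw [k2, Submodule.finrank_map_subtype_eq]
  have h4 := LinearMap.finrank_range_add_finrank_ker b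
  have h5 := LinearMap.finrank_range_add_finrank_ker b.flip
  rw [finrank_range_flip] at h5
  omega

/-! ### Multiplication by the variables on the span of `E`. -/

/-- The matrix of multiplication by `x_i` on the span of the monomials with exponent in `E`. -/
noncomputable def shiftMatrix (K : Type*) [Field K] (E : Finset (Fin 3 →₀ ℕ)) (i : Fin 3) : Matrix E E K :=
  Matrix.of fun f e => if f.1 = e.1 + Finsupp.single i 1 then 1 else 0

/-- The class of the monomial with exponent `a` in the span of the monomials in `E`. -/
noncomputable def monomialClass (K : Type*) [Field K] (E : Finset (Fin 3 →₀ ℕ)) (a : Fin 3 →₀ ℕ) : E → K :=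
  fun f => if (f : Fin 3 →₀ ℕ) = a then 1 else 0

section shift

variable {K : Type*} [Field K] {E : Finset (Fin 3 →₀ ℕ)}

theorem monomialClass_of_notMem {a : Fin 3 →₀ ℕ} (ha : a ∉ E) : monomialClass K E a = 0 := by
  ext f
  have : (f : Fin 3 →₀ ℕ) ≠ a := fun h => ha (h ▸ f.2)
  simp [monomialClass, this]

theorem monomialClass_coe (e : E) : monomialClass K E e = Pi.single e 1 := by
  ext f
  by_cases h : f = e
  · simp [monomialClass, h]
  · have h' : f.1 ≠ e.1 := fun h' => h (Subtype.ext h')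
    simp [monomialClass, h, h']

theorem mulVec_monomialClass (M : Matrix E E K) (f e : E) :
    (M.mulVec (monomialClass K E e)) f = M f e := by
  rw [monomialClass_coe]
  simp

theorem matrix_ext_monomialClass {M N : Matrix E E K}
    (h : ∀ e ∈ E, M.mulVec (monomialClass K E e) = N.mulVec (monomialClass K E e)) : M = N := by
  ext f e
  rw [← mulVec_monomialClass M, ← mulVec_monomialClass N, h e e.2]

theorem mem_of_add_single_mem (hE : IsLowerSet (E : Set (Fin 3 →₀ ℕ))) {a b : Fin 3 →₀ ℕ}
    (h : a + b ∈ E) : a ∈ E :=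
  hE (show a ≤ a + b from le_self_add) h

theorem shiftMatrix_mulVec_add_single (i : Fin 3) (v : E → K) (g f : E)
    (h : f.1 = g.1 + Finsupp.single i 1) :
    (shiftMatrix K E i).mulVec v f = v g := by
  have : ∀ x : E, ((g : Fin 3 →₀ ℕ) = x ↔ g = x) := fun x => Subtype.ext_iff.symm
  simp [Matrix.mulVec, dotProduct, shiftMatrix, h, this]

theorem exists_of_shiftMatrix_mulVec_ne_zero (i : Fin 3) (v : E → K) (f : E)
    (h : (shiftMatrix K E i).mulVec v f ≠ 0) :
    ∃ g : E, f.1 = g.1 + Finsupp.single i 1 ∧ v g ≠ 0 := by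
  obtain ⟨g, -, hg⟩ := Finset.exists_ne_zero_of_sum_ne_zero h
  refine ⟨g, ?_, right_ne_zero_of_mul hg⟩
  by_contra hne
  exact hg (by simp [shiftMatrix, hne])

theorem shiftMatrix_mulVec_monomialClass (hE : IsLowerSet (E : Set (Fin 3 →₀ ℕ))) (i : Fin 3)
    (a : Fin 3 →₀ ℕ) :
    (shiftMatrix K E i).mulVec (monomialClass K E a) =
      monomialClass K E (a + Finsupp.single i 1) := by
  by_cases ha : a ∈ E
  · ext f
    rw [show a = ((⟨a, ha⟩ : E) : Fin 3 →₀ ℕ) from rfl, mulVec_monomialClass]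
    rfl
  · rw [monomialClass_of_notMem ha, monomialClass_of_notMem, Matrix.mulVec_zero]
    exact fun h => ha (mem_of_add_single_mem hE h)

theorem shiftMatrix_comm (hE : IsLowerSet (E : Set (Fin 3 →₀ ℕ))) (i j : Fin 3) :
    shiftMatrix K E i * shiftMatrix K E j = shiftMatrix K E j * shiftMatrix K E i := by
  refine matrix_ext_monomialClass fun e _ => ?_
  simp only [← Matrix.mulVec_mulVec, shiftMatrix_mulVec_monomialClass hE]
  rw [add_right_comm]

end shift

/-! ### The Hessian of the commutator potential. -/

/-- The `i`-th component of a triple of matrices. -/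
noncomputable def component {K : Type*} [Field K] {E : Finset (Fin 3 →₀ ℕ)} (D : Fin 3 × E × E → K)
    (i : Fin 3) : Matrix E E K :=
  Matrix.of fun f e => D (i, f, e)

/-- The `k`-th component of the linearised commutation relations. -/
noncomputable def curl {K : Type*} [Field K] {E : Finset (Fin 3 →₀ ℕ)} (D : Fin 3 × E × E → K)
    (k : Fin 3) : Matrix E E K :=
  (shiftMatrix K E (k + 1) * component D (k + 2) - component D (k + 2) * shiftMatrix K E (k + 1)) -
    (shiftMatrix K E (k + 2) * component D (k + 1) - component D (k + 1) * shiftMatrix K E (k + 2))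

/-- The Hessian of `tr (X₀ (X₁ X₂ - X₂ X₁))` at the triple of shift matrices. -/
noncomputable def hessianForm (K : Type*) [Field K] (E : Finset (Fin 3 →₀ ℕ)) :
    (Fin 3 × E × E → K) →ₗ[K] (Fin 3 × E × E → K) →ₗ[K] K :=
  have hadd : ∀ (D D' : Fin 3 × E × E → K) i,
      component (D + D') i = component D i + component D' i := fun _ _ _ => rfl
  have hsmul : ∀ (c : K) (D : Fin 3 × E × E → K) i,
      component (c • D) i = c • component D i := fun _ _ _ => rfl
  LinearMap.mk₂ K (fun D D' => ∑ k, (curl D k * component D' k).trace)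
    (fun D D' D'' => by
      rw [← Finset.sum_add_distrib]
      refine Finset.sum_congr rfl fun k _ => ?_
      rw [← Matrix.trace_add]
      congr 1
      simp only [curl, hadd]
      noncomm_ring)
    (fun c D D' => by
      rw [Finset.smul_sum]
      refine Finset.sum_congr rfl fun k _ => ?_
      rw [← Matrix.trace_smul, ← Matrix.smul_mul]
      simp only [curl, hsmul, Matrix.mul_smul, Matrix.smul_mul, smul_sub])
    (fun D D' D'' => by
      rw [← Finset.sum_add_distrib]
      refine Finset.sum_congr rfl fun k _ => ?_
      rw [hadd, mul_add, Matrix.trace_add])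
    (fun c D D' => by
      rw [Finset.smul_sum]
      refine Finset.sum_congr rfl fun k _ => ?_
      rw [hsmul, Matrix.mul_smul, Matrix.trace_smul])

section hessian

variable {K : Type*} [Field K] {E : Finset (Fin 3 →₀ ℕ)}

theorem hessianForm_apply (D D' : Fin 3 × E × E → K) :
    hessianForm K E D D' = ∑ k, (curl D k * component D' k).trace := rfl

theorem hessianForm_eq_sum (D D' : Fin 3 × E × E → K) :
    hessianForm K E D D' = ∑ k : Fin 3,
      ((shiftMatrix K E (k + 1) * component D (k + 2) * component D' k).trace -
        (shiftMatrix K E (k + 1) * component D' k * component D (k + 2)).trace -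
        (shiftMatrix K E (k + 2) * component D (k + 1) * component D' k).trace +
        (shiftMatrix K E (k + 2) * component D' k * component D (k + 1)).trace) := by
  rw [hessianForm_apply]
  refine Finset.sum_congr rfl fun k _ => ?_
  simp only [curl, sub_mul, Matrix.trace_sub]
  rw [Matrix.trace_mul_cycle (component D (k + 2)) (shiftMatrix K E (k + 1)),
    Matrix.trace_mul_cycle (component D' k) (component D (k + 2)),
    Matrix.trace_mul_cycle (component D (k + 1)) (shiftMatrix K E (k + 2)),
    Matrix.trace_mul_cycle (component D' k) (component D (k + 1))]
  ring

theorem hessianForm_symm (D D' : Fin 3 × E × E → K) :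
    hessianForm K E D D' = hessianForm K E D' D := by
  rw [hessianForm_eq_sum, hessianForm_eq_sum]
  simp only [Fin.sum_univ_three, Fin.isValue, Fin.reduceAdd, zero_add]
  ring

/-- The critical equations of the potential are the commutation relations, so the radical of the
Hessian consists of the first-order deformations that preserve commutativity. -/
theorem hessianForm_eq_zero_iff (D : Fin 3 × E × E → K) :
    hessianForm K E D = 0 ↔ ∀ i j : Fin 3,
      shiftMatrix K E i * component D j + component D i * shiftMatrix K E j =
        shiftMatrix K E j * component D i + component D j * shiftMatrix K E i := by
  have h1 : hessianForm K E D = 0 ↔ ∀ k, curl D k = 0 := by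
    constructor
    · intro h k
      ext f e
      -- The indices are transposed because the trace against the matrix unit at `(e, f)` reads off
      -- the entry `(f, e)`.
      have := LinearMap.congr_fun h (Pi.single (k, e, f) 1)
      rw [hessianForm_apply, Finset.sum_eq_single k] at this
      · have hc : component (Pi.single (k, e, f) (1 : K)) k = Matrix.single e f (1 : K) := by
          ext x y
          simp [component, Pi.single_apply, Matrix.single_apply, eq_comm]
        rw [hc, Matrix.trace_mul_comm, Matrix.trace_single_mul] at this
        simpa using this
      · intro k' _ hk'
        have hc : component (Pi.single (k, e, f) (1 : K)) k' = 0 := by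
          ext x y
          simp [component, hk']
        simp [hc]
      · simp
    · intro h
      ext D'
      simp [hessianForm_apply, h]
  rw [h1]
  have h2 : ∀ A B C D : Matrix E E K, (A - B) - (C - D) = 0 ↔ A + D = C + B := fun A B C D => by
    rw [← sub_eq_zero (a := A + D)]
    exact Eq.congr (by abel) rfl
  simp only [curl, h2]
  constructor
  · intro h i j
    have hij : i = j ∨ ∃ k, (i = k + 1 ∧ j = k + 2) ∨ (i = k + 2 ∧ j = k + 1) := by
      decide +revert
    obtain rfl | ⟨k, ⟨rfl, rfl⟩ | ⟨rfl, rfl⟩⟩ := hij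
    · rfl
    · exact h k
    · exact (h k).symm
  · exact fun h k => h _ _

/-! ### The `z`-grading of the Hessian. -/

/-- The `z`-degree of the matrix entry `(i, f, e)` of a triple is negative. -/
noncomputable def IsNegIndex (E : Finset (Fin 3 →₀ ℕ)) (j : Fin 3 × E × E) : Prop :=
  j.2.1.1 2 < (j.2.2.1 + Finsupp.single j.1 1 : Fin 3 →₀ ℕ) 2

theorem trace_shiftMatrix_mul_eq_zero (A B : Matrix E E K) (i : Fin 3)
    (h : ∀ f g e : E, f.1 = g.1 + Finsupp.single i 1 → A g e * B e f = 0) :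
    (shiftMatrix K E i * A * B).trace = 0 := by
  refine Finset.sum_eq_zero fun f _ => ?_
  rw [Matrix.diag_apply, Matrix.mul_assoc, Matrix.mul_apply]
  refine Finset.sum_eq_zero fun g _ => ?_
  by_cases hfg : f.1 = g.1 + Finsupp.single i 1
  · rw [Matrix.mul_apply, Finset.sum_eq_zero fun e _ => h f g e hfg, mul_zero]
  · simp [shiftMatrix, hfg]

theorem hessianForm_eq_zero_of_entries (D D' : Fin 3 × E × E → K)
    (h : ∀ i j k : Fin 3, i ≠ j → i ≠ k → j ≠ k → ∀ f g e : E,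
      f.1 = g.1 + Finsupp.single i 1 →
        D (j, g, e) * D' (k, e, f) = 0 ∧ D' (j, g, e) * D (k, e, f) = 0) :
    hessianForm K E D D' = 0 := by
  rw [hessianForm_eq_sum]
  refine Finset.sum_eq_zero fun k _ => ?_
  have e1 : k + 1 ≠ k + 2 := by decide +revert
  have e2 : k + 1 ≠ k := by decide +revert
  have e3 : k + 2 ≠ k := by decide +revert
  rw [trace_shiftMatrix_mul_eq_zero (component D (k + 2)) (component D' k) (k + 1)
      fun f g e hf => (h _ _ _ e1 e2 e3 f g e hf).1,
    trace_shiftMatrix_mul_eq_zero (component D' k) (component D (k + 2)) (k + 1)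
      fun f g e hf => (h _ _ _ e2 e1 e3.symm f g e hf).2,
    trace_shiftMatrix_mul_eq_zero (component D (k + 1)) (component D' k) (k + 2)
      fun f g e hf => (h _ _ _ e1.symm e3 e2 f g e hf).1,
    trace_shiftMatrix_mul_eq_zero (component D' k) (component D (k + 1)) (k + 2)
      fun f g e hf => (h _ _ _ e3 e1.symm e2.symm f g e hf).2]
  ring

/-- Each trace term runs around a closed path through one shift and two entries. Exactly one of the
three distinct directions is `z`, so the `z`-degrees of the two entries add up to `-1`. They can be
neither both negative nor, as the next lemma uses, both nonnegative. -/
theorem hessianForm_eq_zero_of_neg (D D' : Fin 3 × E × E → K)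
    (hD : D ∈ coordSubspace K (IsNegIndex E)) (hD' : D' ∈ coordSubspace K (IsNegIndex E)) :
    hessianForm K E D D' = 0 := by
  refine hessianForm_eq_zero_of_entries D D' fun i j k hij hik hjk f g e hf => ?_
  by_contra hne
  have h12 : IsNegIndex E (j, g, e) ∧ IsNegIndex E (k, e, f) := by
    by_contra hneg
    rw [not_and_or] at hneg
    rcases hneg with hneg | hneg <;> exact hne (by simp [hD _ hneg, hD' _ hneg])
  obtain ⟨h1, h2⟩ := h12
  simp only [IsNegIndex, hf, Finsupp.add_apply, Finsupp.single_apply] at h1 h2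
  have hle : ∀ i j k : Fin 3, i ≠ j → i ≠ k → j ≠ k →
      (if i = 2 then 1 else 0) + (if j = 2 then 1 else 0) + (if k = 2 then 1 else 0) ≤ 1 := by
    decide
  have := hle i j k hij hik hjk
  omega

theorem hessianForm_eq_zero_of_nonneg (D D' : Fin 3 × E × E → K)
    (hD : D ∈ coordSubspace K fun j => ¬ IsNegIndex E j)
    (hD' : D' ∈ coordSubspace K fun j => ¬ IsNegIndex E j) :
    hessianForm K E D D' = 0 := by
  refine hessianForm_eq_zero_of_entries D D' fun i j k hij hik hjk f g e hf => ?_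
  by_contra hne
  have h12 : ¬ IsNegIndex E (j, g, e) ∧ ¬ IsNegIndex E (k, e, f) := by
    by_contra hneg
    rw [not_and_or] at hneg
    rcases hneg with hneg | hneg <;> exact hne (by simp [hD _ hneg, hD' _ hneg])
  obtain ⟨h1, h2⟩ := h12
  simp only [IsNegIndex, hf, Finsupp.add_apply, Finsupp.single_apply] at h1 h2
  have hle : ∀ i j k : Fin 3, i ≠ j → i ≠ k → j ≠ k →
      1 ≤ (if i = 2 then 1 else 0) + (if j = 2 then 1 else 0) + (if k = 2 then 1 else 0) := by
    decide
  have := hle i j k hij hik hjk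
  omega

end hessian

-- Directions `x` and `y` have surplus `#{f 2 = e 2}` of nonnegative over negative indices, while in
-- direction `z` the shift by one reverses the sign; the net surplus is one copy.
open Classical in
theorem card_negIndex (E : Finset (Fin 3 →₀ ℕ)) :
    Fintype.card {j // ¬ IsNegIndex E j} =
      Fintype.card {j // IsNegIndex E j} + Fintype.card {p : E × E // p.1.1 2 = p.2.1 2} ∧
    2 * Fintype.card {p : E × E // p.1.1 2 < p.2.1 2} +
      Fintype.card {p : E × E // p.1.1 2 = p.2.1 2} = E.card * E.card := by
  have hswap : ∑ f : E, ∑ e : E, (if e.1 2 < f.1 2 then 1 else 0) =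
      ∑ f : E, ∑ e : E, if f.1 2 < e.1 2 then 1 else 0 := Finset.sum_comm
  have h1 : ∀ f e : E, (if ¬ f.1 2 < e.1 2 then 1 else 0) =
      (if f.1 2 = e.1 2 then 1 else 0) + if e.1 2 < f.1 2 then 1 else 0 := fun f e => by
    split_ifs <;> omega
  have h2 : ∀ f e : E, (if f.1 2 < e.1 2 + 1 then 1 else 0) =
      (if f.1 2 = e.1 2 then 1 else 0) + if f.1 2 < e.1 2 then 1 else 0 := fun f e => by
    split_ifs <;> omega
  have h3 : ∀ f e : E, (if ¬ f.1 2 < e.1 2 + 1 then 1 else 0) =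
      if e.1 2 < f.1 2 then 1 else 0 := fun f e => by
    split_ifs <;> omega
  have h4 : ∑ f : E, ∑ e : E, ((if f.1 2 < e.1 2 then 1 else 0) +
      (if e.1 2 < f.1 2 then 1 else 0) + if f.1 2 = e.1 2 then 1 else 0) = E.card * E.card := by
    rw [Finset.sum_congr rfl fun f _ => Finset.sum_congr rfl fun e _ =>
      show _ = 1 by split_ifs <;> omega]
    simp
  simp only [Finset.sum_add_distrib, hswap] at h4
  simp only [Fintype.card_subtype, Finset.card_filter, Fintype.sum_prod_type, Fin.sum_univ_three,
    IsNegIndex, Finsupp.add_apply, Finsupp.single_apply, Fin.isValue, Fin.reduceEq, if_true,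
    if_false, add_zero, h1, h2, h3, Finset.sum_add_distrib, hswap]
  omega

theorem finrank_ker_hessianForm (K : Type*) [Field K] (E : Finset (Fin 3 →₀ ℕ)) :
    Module.finrank K (LinearMap.ker (hessianForm K E)) +
      2 * Nat.card {p : E × E // p.1.1 2 < p.2.1 2} =
    2 * Module.finrank K
      ↥(LinearMap.ker (hessianForm K E) ⊓ coordSubspace K (IsNegIndex E)) + E.card * E.card := by
  classical
  have h := finrank_ker_of_isotropic (hessianForm K E) hessianForm_symm _ _
    (isCompl_coordSubspace K (IsNegIndex E))
    (fun D hD D' hD' => hessianForm_eq_zero_of_neg D D' hD hD')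
    (fun D hD D' hD' => hessianForm_eq_zero_of_nonneg D D' hD hD')
  rw [finrank_coordSubspace, finrank_coordSubspace] at h
  obtain ⟨h1, h2⟩ := card_negIndex E
  rw [Nat.card_eq_fintype_card]
  omega

/-! ### Partially linear maps as the radical of the Hessian. -/

theorem exponent_induction {p : (Fin 3 →₀ ℕ) → Prop} (h0 : p 0)
    (hs : ∀ a i, p a → p (a + Finsupp.single i 1)) (a : Fin 3 →₀ ℕ) : p a := by
  have key : ∀ a b, p b → p (b + a) := fun a => by
    induction a using Finsupp.induction_linear with
    | zero => simp
    | add x y hx hy => exact fun b hb => add_assoc b x y ▸ hy _ (hx _ hb)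
    | single i n =>
      induction n with
      | zero => simp
      | succ n ih =>
        intro b hb
        rw [Finsupp.single_add, ← add_assoc]
        exact hs _ _ (ih b hb)
  simpa using key a 0 h0

/-- The values on monomials of the `K`-linear maps from the polynomial ring to the span of `E`
which send `1` to `0` and which are linear over the polynomial ring on the monomials outside `E`. -/
def partialHoms (K : Type*) [Field K] (E : Finset (Fin 3 →₀ ℕ)) :
    Submodule K ((Fin 3 →₀ ℕ) → E → K) where
  carrier := {ψ | ψ 0 = 0 ∧ ∀ a ∉ E, ∀ i,
    ψ (a + Finsupp.single i 1) = (shiftMatrix K E i).mulVec (ψ a)}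
  add_mem' := fun {ψ χ} hψ hχ => ⟨by simp [hψ.1, hχ.1], fun a ha i => by
    simp [hψ.2 a ha i, hχ.2 a ha i, Matrix.mulVec_add]⟩
  zero_mem' := ⟨rfl, fun a _ i => by simp⟩
  smul_mem' := fun c ψ hψ => ⟨by simp [hψ.1], fun a ha i => by
    simp [hψ.2 a ha i, Matrix.mulVec_smul]⟩

/-- The triple of matrices measuring the failure of linearity. -/
noncomputable def linearityDefect (K : Type*) [Field K] (E : Finset (Fin 3 →₀ ℕ)) :
    partialHoms K E →ₗ[K] (Fin 3 × E × E → K) where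
  toFun ψ j := (ψ.1 (j.2.2.1 + Finsupp.single j.1 1) -
    (shiftMatrix K E j.1).mulVec (ψ.1 j.2.2.1)) j.2.1
  map_add' ψ χ := by
    ext j
    simp only [Submodule.coe_add, Pi.add_apply, Matrix.mulVec_add, Pi.sub_apply]
    ring
  map_smul' c ψ := by
    ext j
    simp only [Submodule.coe_smul, Pi.smul_apply, Matrix.mulVec_smul, Pi.sub_apply, smul_eq_mul,
      RingHom.id_apply]
    ring

section partialHoms

variable {K : Type*} [Field K] {E : Finset (Fin 3 →₀ ℕ)}

theorem component_linearityDefect_mulVec (ψ : partialHoms K E) (i : Fin 3) (a : Fin 3 →₀ ℕ) :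
    (component (linearityDefect K E ψ) i).mulVec (monomialClass K E a) =
      ψ.1 (a + Finsupp.single i 1) - (shiftMatrix K E i).mulVec (ψ.1 a) := by
  by_cases ha : a ∈ E
  · ext f
    exact mulVec_monomialClass _ f ⟨a, ha⟩
  · rw [monomialClass_of_notMem ha, Matrix.mulVec_zero, ψ.2.2 a ha i, sub_self]

theorem linearityDefect_injective : Function.Injective (linearityDefect K E) := by
  rw [injective_iff_map_eq_zero]
  intro ψ hψ
  ext a : 2
  induction a using exponent_induction with
  | h0 => exact ψ.2.1
  | hs a i ih =>
    have h := component_linearityDefect_mulVec ψ i a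
    have h0 : component (0 : Fin 3 × E × E → K) i = 0 := rfl
    rw [hψ, ih, h0] at h
    simpa using h.symm

theorem linearityDefect_mem_ker (hE : IsLowerSet (E : Set (Fin 3 →₀ ℕ))) (ψ : partialHoms K E) :
    linearityDefect K E ψ ∈ LinearMap.ker (hessianForm K E) := by
  rw [LinearMap.mem_ker, hessianForm_eq_zero_iff]
  intro i j
  refine matrix_ext_monomialClass fun e _ => ?_
  simp only [Matrix.add_mulVec, ← Matrix.mulVec_mulVec, shiftMatrix_mulVec_monomialClass hE,
    component_linearityDefect_mulVec, Matrix.mulVec_sub]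
  rw [add_right_comm]
  simp only [Matrix.mulVec_mulVec, shiftMatrix_comm hE j i]
  abel

/-- Over the dual numbers the matrices `shiftMatrix K E i + ε D_i` commute, so monomials in them are
well defined. Applied to the class of `1`, they have the desired map as `ε`-part. -/
theorem exists_linearityDefect_eq (hE : IsLowerSet (E : Set (Fin 3 →₀ ℕ)))
    (D : Fin 3 × E × E → K) (hD : D ∈ LinearMap.ker (hessianForm K E)) :
    ∃ ψ, linearityDefect K E ψ = D := by
  rw [LinearMap.mem_ker, hessianForm_eq_zero_iff] at hD
  -- The pair `(v₁, v₂)` stands for `v₁ + ε v₂`.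
  let M : Fin 3 → Module.End K ((E → K) × (E → K)) := fun i =>
    ((shiftMatrix K E i).mulVecLin ∘ₗ LinearMap.fst K _ _).prod
      ((shiftMatrix K E i).mulVecLin ∘ₗ LinearMap.snd K _ _ +
        (component D i).mulVecLin ∘ₗ LinearMap.fst K _ _)
  have hM : ∀ i v, M i v = ((shiftMatrix K E i).mulVec v.1,
      (shiftMatrix K E i).mulVec v.2 + (component D i).mulVec v.1) := fun _ _ => rfl
  have hcomm : ∀ i j, Commute (M i) (M j) := fun i j => by
    refine LinearMap.ext fun v => ?_
    rw [Module.End.mul_apply, Module.End.mul_apply, hM, hM, hM, hM]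
    refine Prod.ext ?_ ?_
    · simp only [Matrix.mulVec_mulVec, shiftMatrix_comm hE i j]
    · have h := congrArg (fun N => N.mulVec v.1) (hD i j)
      simp only [Matrix.add_mulVec] at h
      simp only [Matrix.mulVec_add, Matrix.mulVec_mulVec, shiftMatrix_comm hE i j, add_assoc, h]
  let P : (Fin 3 →₀ ℕ) → Module.End K ((E → K) × (E → K)) := fun a =>
    M 0 ^ a 0 * (M 1 ^ a 1 * M 2 ^ a 2)
  have hP : ∀ a i, P (a + Finsupp.single i 1) = M i * P a := fun a i => by
    have c1 : ∀ i j n, M j ^ n * M i = M i * M j ^ n := fun i j n => (hcomm j i).pow_left n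
    have h : i = 0 ∨ i = 1 ∨ i = 2 := by decide +revert
    obtain rfl | rfl | rfl := h
    · simp [P, pow_succ', mul_assoc]
    · simp [P, pow_succ', ← mul_assoc, c1]
    · simp only [P]
      simp only [Finsupp.add_apply, Finsupp.single_apply, Fin.isValue, Fin.reduceEq, if_true,
        if_false, add_zero, pow_succ', ← mul_assoc, c1]
  let w : (Fin 3 →₀ ℕ) → (E → K) × (E → K) := fun a => P a (monomialClass K E 0, 0)
  have hw0 : w 0 = (monomialClass K E 0, 0) := by simp [w, P]
  have hws : ∀ a i, w (a + Finsupp.single i 1) = M i (w a) := fun a i => by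
    simp only [w, hP, Module.End.mul_apply]
  have hw1 : ∀ a, (w a).1 = monomialClass K E a := fun a => by
    induction a using exponent_induction with
    | h0 => rw [hw0]
    | hs a i ih => rw [hws, hM, ih, shiftMatrix_mulVec_monomialClass hE]
  have hw2 : ∀ a i, (w (a + Finsupp.single i 1)).2 =
      (shiftMatrix K E i).mulVec (w a).2 + (component D i).mulVec (monomialClass K E a) :=
    fun a i => by rw [hws, hM, hw1]
  refine ⟨⟨fun a => (w a).2, by simp [hw0], fun a ha i => ?_⟩, ?_⟩
  · simp only
    rw [hw2, monomialClass_of_notMem ha, Matrix.mulVec_zero, add_zero]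
  · ext ⟨i, f, e⟩
    simp only [linearityDefect, LinearMap.coe_mk, AddHom.coe_mk, hw2, add_sub_cancel_left,
      mulVec_monomialClass]
    rfl

/-- A defect of negative `z`-degree forces `ψ` to lower the `z`-degree strictly: where it would not,
the defect entry vanishes and `ψ` is transported from a smaller monomial, down to `ψ 0 = 0`. -/
theorem lt_of_linearityDefect_mem (ψ : partialHoms K E)
    (hψ : linearityDefect K E ψ ∈ coordSubspace K (IsNegIndex E)) (a : Fin 3 →₀ ℕ) (f : E)
    (h : ψ.1 a f ≠ 0) : f.1 2 < a 2 := by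
  induction a using exponent_induction generalizing f with
  | h0 => exact absurd (congrFun ψ.2.1 f) h
  | hs a i ih =>
    by_contra hlt
    have hd : ψ.1 (a + Finsupp.single i 1) f = (shiftMatrix K E i).mulVec (ψ.1 a) f := by
      rw [← sub_eq_zero]
      by_cases ha : a ∈ E
      · exact hψ (i, f, ⟨a, ha⟩) hlt
      · rw [ψ.2.2 a ha i, sub_self]
    rw [hd] at h
    obtain ⟨g, hg, hne⟩ := exists_of_shiftMatrix_mulVec_ne_zero i _ f h
    have := ih g hne
    rw [hg] at hlt
    simp only [Finsupp.add_apply] at hlt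
    omega

end partialHoms

/-! ### The negative half of the radical for Borel-stable `E`. -/

/-- The combinatorial exchange property of the exponents outside a Borel-fixed ideal. -/
def IsBorelStable (E : Finset (Fin 3 →₀ ℕ)) : Prop :=
  ∀ (b : Fin 3 →₀ ℕ) (i j : Fin 3), i < j → b + Finsupp.single i 1 ∈ E →
    b + Finsupp.single j 1 ∈ E

/-- The pairs `(w, e)` where `w` is annihilated by `x` and `y`, and `e` is on top of its column
and not below `w`. -/
def socleColumnPairs (E : Finset (Fin 3 →₀ ℕ)) : Set (E × E) :=
  {p | p.1.1 + Finsupp.single 0 1 ∉ E ∧ p.1.1 + Finsupp.single 1 1 ∉ E ∧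
    p.2.1 + Finsupp.single 2 1 ∉ E ∧ p.1.1 2 ≤ p.2.1 2}

section bound

variable {K : Type*} [Field K] {E : Finset (Fin 3 →₀ ℕ)}

/-- Induction on the `z`-degree shows that `ψ` vanishes on the monomials of the ideal. The only
freedom at each level sits on monomials just above the top of a column, with values annihilated by
`x` and `y`. -/
theorem partialHom_eq_zero (hB : IsBorelStable E)
    (ψ : partialHoms K E) (hψ : linearityDefect K E ψ ∈ coordSubspace K (IsNegIndex E))
    (h1 : ∀ f e : E, f.1 2 < e.1 2 → ψ.1 e.1 f = 0)
    (h2 : ∀ p ∈ socleColumnPairs E, ψ.1 (p.2.1 + Finsupp.single 2 1) p.1 = 0) : ψ = 0 := by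
  have hlt := lt_of_linearityDefect_mem ψ hψ
  have hout : ∀ n, ∀ a ∉ E, a 2 = n → ψ.1 a = 0 := by
    intro n
    induction n with
    | zero =>
      intro a _ han
      ext f
      by_contra hne
      have := hlt a f hne
      omega
    | succ n ih =>
      intro a ha han
      obtain ⟨b, rfl⟩ : ∃ b, a = b + Finsupp.single 2 1 :=
        ⟨a - Finsupp.single 2 1, (tsub_add_cancel_of_le (by
          rw [Finsupp.single_le_iff]; omega)).symm⟩
      have hbn : b 2 = n := by simpa using han
      have hzero : ∀ c ∉ E, c 2 = n → ψ.1 (c + Finsupp.single 2 1) = 0 := fun c hc hcn => by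
        rw [ψ.2.2 c hc 2, ih c hc hcn, Matrix.mulVec_zero]
      by_cases hb : b ∈ E
      swap
      · exact hzero b hb hbn
      ext f
      by_contra hne
      have hf := hlt _ f hne
      -- Since `b z` is outside `E`, exchange puts `b x_i` outside `E` too, where `ψ` already
      -- vanishes. So `x_i ψ(b z) = z ψ(b x_i) = 0`.
      have hsoc : ∀ i : Fin 3, i < 2 → f.1 + Finsupp.single i 1 ∉ E := fun i hi hmem => by
        apply hne
        have hbi : b + Finsupp.single i 1 ∉ E := fun h => ha (hB b i 2 hi h)
        have h3 := hzero _ hbi (by simp [hbn, hi.ne])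
        rw [add_right_comm, ψ.2.2 _ ha i] at h3
        rw [← shiftMatrix_mulVec_add_single i (ψ.1 _) f ⟨_, hmem⟩ rfl, h3]
        rfl
      refine hne (h2 (f, ⟨b, hb⟩) ⟨hsoc 0 (by decide), hsoc 1 (by decide), ha, ?_⟩)
      simp only [Finsupp.add_apply, Finsupp.single_apply, if_true] at hf
      show f.1 2 ≤ b 2
      omega
  ext a f
  by_cases ha : a ∈ E
  · by_cases hf : f.1 2 < a 2
    · exact h1 f ⟨a, ha⟩ hf
    · by_contra hne
      exact hf (hlt a f hne)
  · rw [hout _ a ha rfl]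
    rfl

theorem finrank_ker_inf_le (hE : IsLowerSet (E : Set (Fin 3 →₀ ℕ))) (hB : IsBorelStable E) :
    Module.finrank K ↥(LinearMap.ker (hessianForm K E) ⊓ coordSubspace K (IsNegIndex E)) ≤
      Nat.card {p : E × E // p.1.1 2 < p.2.1 2} + Nat.card (socleColumnPairs E) := by
  classical
  set Q := LinearMap.ker (hessianForm K E) ⊓ coordSubspace K (IsNegIndex E) with hQ
  let S := Q.comap (linearityDefect K E)
  have hS : S.map (linearityDefect K E) = Q := by
    refine Submodule.map_comap_eq_of_le ?_
    rintro D ⟨hD, -⟩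
    obtain ⟨ψ, rfl⟩ := exists_linearityDefect_eq hE D hD
    exact LinearMap.mem_range_self _ _
  rw [← hS, ← (Submodule.equivMapOfInjective _ linearityDefect_injective S).finrank_eq]
  let F : S →ₗ[K] ({p : E × E // p.1.1 2 < p.2.1 2} → K) × (socleColumnPairs E → K) :=
    { toFun := fun ψ => (fun p => ψ.1.1 p.1.2.1 p.1.1,
        fun p => ψ.1.1 (p.1.2.1 + Finsupp.single 2 1) p.1.1)
      map_add' := fun _ _ => rfl
      map_smul' := fun _ _ => rfl }
  have hF : Function.Injective F := by
    rw [injective_iff_map_eq_zero]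
    intro ψ hψ
    have ha := congrArg Prod.fst hψ
    have hb := congrArg Prod.snd hψ
    exact Subtype.ext (partialHom_eq_zero hB ψ.1 ψ.2.2
      (fun f e hfe => congrFun ha ⟨(f, e), hfe⟩) (fun p hp => congrFun hb ⟨p, hp⟩))
  refine (LinearMap.finrank_le_finrank_of_injective hF).trans ?_
  rw [Module.finrank_prod, Module.finrank_fintype_fun_eq_card, Module.finrank_fintype_fun_eq_card,
    Nat.card_eq_fintype_card, Nat.card_eq_fintype_card]

instance : FiniteDimensional K (partialHoms K E) :=
  Module.Finite.of_injective _ linearityDefect_injective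

/-- The pairs with `f 2 < e 2` cancel between the radical formula and the bound on its negative
half. -/
theorem finrank_partialHoms_le (hE : IsLowerSet (E : Set (Fin 3 →₀ ℕ))) (hB : IsBorelStable E) :
    Module.finrank K (partialHoms K E) ≤ 2 * Nat.card (socleColumnPairs E) + E.card * E.card := by
  have h1 : Module.finrank K (partialHoms K E) ≤
      Module.finrank K (LinearMap.ker (hessianForm K E)) :=
    LinearMap.finrank_le_finrank_of_injective
      (f := (linearityDefect K E).codRestrict _ (linearityDefect_mem_ker hE))
      (fun _ _ h => linearityDefect_injective (congrArg Subtype.val h))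
  have h2 := finrank_ker_hessianForm K E
  have h3 := finrank_ker_inf_le (K := K) hE hB
  omega

end bound

/-! ### Counting exponents and socle-column pairs. -/

/-- The exponent vector of `x ^ a * y ^ b * z ^ c`. -/
noncomputable def exponent (a b c : ℕ) : Fin 3 →₀ ℕ := Finsupp.equivFunOnFinite.symm ![a, b, c]

section exponent

@[simp] theorem exponent_zero (a b c : ℕ) : exponent a b c 0 = a := rfl
@[simp] theorem exponent_one (a b c : ℕ) : exponent a b c 1 = b := rfl
@[simp] theorem exponent_two (a b c : ℕ) : exponent a b c 2 = c := rfl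

theorem exponent_le_iff {a b : Fin 3 →₀ ℕ} : a ≤ b ↔ a 0 ≤ b 0 ∧ a 1 ≤ b 1 ∧ a 2 ≤ b 2 := by
  rw [Finsupp.le_def, Fin.forall_fin_succ, Fin.forall_fin_two]
  rfl

theorem exponent_ext {a b : Fin 3 →₀ ℕ} (h0 : a 0 = b 0) (h1 : a 1 = b 1) (h2 : a 2 = b 2) :
    a = b :=
  le_antisymm (exponent_le_iff.mpr ⟨h0.le, h1.le, h2.le⟩)
    (exponent_le_iff.mpr ⟨h0.ge, h1.ge, h2.ge⟩)

theorem degree_eq_sum_three (a : Fin 3 →₀ ℕ) : a.degree = a 0 + a 1 + a 2 := by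
  rw [Finsupp.degree_eq_sum, Fin.sum_univ_three]

end exponent

/-- The exponents of the monomials of degree `n`. -/
noncomputable def degreeLayer (n : ℕ) : Finset (Fin 3 →₀ ℕ) := Finset.finsuppAntidiag Finset.univ n

/-- The exponents of the monomials of degree less than `n`. -/
noncomputable def degreeSimplex (n : ℕ) : Finset (Fin 3 →₀ ℕ) :=
  (Finset.range n).biUnion degreeLayer

section degree

theorem mem_degreeLayer {n : ℕ} {a : Fin 3 →₀ ℕ} : a ∈ degreeLayer n ↔ a.degree = n := by
  simp [degreeLayer, Finsupp.degree_eq_sum]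

theorem mem_degreeSimplex {n : ℕ} {a : Fin 3 →₀ ℕ} : a ∈ degreeSimplex n ↔ a.degree < n := by
  simp [degreeSimplex, mem_degreeLayer]

theorem card_degreeLayer (n : ℕ) : (degreeLayer n).card = (n + 2).choose 2 := by
  rw [degreeLayer, Finset.card_finsuppAntidiag_nat_eq_choose, Finset.card_univ, Fintype.card_fin,
    show 3 + n - 1 = n + 2 by omega, Nat.choose_symm_add]

theorem card_degreeSimplex (n : ℕ) : (degreeSimplex n).card = (n + 2).choose 3 := by
  rw [degreeSimplex, Finset.card_biUnion]
  · induction n with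
    | zero => rfl
    | succ n ih => rw [Finset.sum_range_succ, ih, card_degreeLayer, add_comm]; rfl
  · intro i _ j _ hij
    refine Finset.disjoint_left.mpr ?_
    intro a hi hj
    exact hij ((mem_degreeLayer.mp hi).symm.trans (mem_degreeLayer.mp hj))

end degree

section borel

variable {E : Finset (Fin 3 →₀ ℕ)}

theorem IsBorelStable.exponent_one_mem (hB : IsBorelStable E) (r : ℕ) :
    ∀ a b c, exponent (a + r) b c ∈ E → exponent a (b + r) c ∈ E := by
  induction r with
  | zero => exact fun _ _ _ h => h
  | succ r ih =>
    intro a b c h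
    have h1 := hB (exponent (a + r) b c) 0 1 (by decide) (by
      convert h using 1
      refine exponent_ext ?_ ?_ ?_ <;> simp [add_assoc])
    have h2 := ih a (b + 1) c (by
      convert h1 using 1
      refine exponent_ext ?_ ?_ ?_ <;> simp)
    convert h2 using 2
    omega

theorem IsBorelStable.exponent_two_mem (hB : IsBorelStable E) (r : ℕ) :
    ∀ a b c, exponent (a + r) b c ∈ E → exponent a b (c + r) ∈ E := by
  induction r with
  | zero => exact fun _ _ _ h => h
  | succ r ih =>
    intro a b c h
    have h1 := hB (exponent (a + r) b c) 0 2 (by decide) (by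
      convert h using 1
      refine exponent_ext ?_ ?_ ?_ <;> simp [add_assoc])
    have h2 := ih a b (c + 1) (by
      convert h1 using 1
      refine exponent_ext ?_ ?_ ?_ <;> simp)
    convert h2 using 2
    omega

/-- Start from a power of `x` of the right total degree, and trade factors `x` for `y` and `z`. -/
theorem IsBorelStable.mem_of_degree_le (hE : IsLowerSet (E : Set (Fin 3 →₀ ℕ)))
    (hB : IsBorelStable E) {q c : ℕ} (h : exponent q 0 c ∈ E) {a : Fin 3 →₀ ℕ}
    (ha : a.degree ≤ q) : a + Finsupp.single 2 c ∈ E := by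
  rw [degree_eq_sum_three] at ha
  have h1 : exponent (a 0 + a 2 + a 1) 0 c ∈ E :=
    hE (exponent_le_iff.mpr ⟨by simp; omega, by simp, by simp⟩) h
  have h2 := hB.exponent_two_mem _ _ _ _ (hB.exponent_one_mem _ _ _ _ h1)
  convert h2 using 1
  refine exponent_ext ?_ ?_ ?_ <;> simp [add_comm]

theorem degreeSimplex_subset (hE : IsLowerSet (E : Set (Fin 3 →₀ ℕ))) (hB : IsBorelStable E)
    {m : ℕ} (hm : ∀ a < m, exponent a 0 0 ∈ E) : degreeSimplex m ⊆ E := by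
  intro a ha
  rw [mem_degreeSimplex] at ha
  simpa using hB.mem_of_degree_le hE (hm _ ha) le_rfl

/-- If `c` is the last height with `x ^ q z ^ c` in `E`, the products of `z ^ (c + 1)` with
monomials of degree less than `q` stay in `E` and lie above that height. -/
theorem choose_le_card_filter (hE : IsLowerSet (E : Set (Fin 3 →₀ ℕ))) (hB : IsBorelStable E)
    {q : ℕ} (hq : exponent q 0 0 ∈ E) :
    (q + 2).choose 3 ≤ {e ∈ E | exponent q 0 (e 2) ∉ E}.card := by
  classical
  have hex : ∃ c, exponent q 0 c ∉ E := by
    by_contra! hall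
    refine Set.infinite_univ (α := ℕ) (Set.Finite.subset
      (Set.Finite.preimage (f := fun c => exponent q 0 c) ?_ E.finite_toSet) fun c _ => hall c)
    exact fun c _ d _ h => DFunLike.congr_fun h (2 : Fin 3)
  obtain ⟨c, hc⟩ : ∃ c, Nat.find hex = c + 1 :=
    Nat.exists_eq_succ_of_ne_zero fun h => (h ▸ Nat.find_spec hex) hq
  have hc1 : exponent q 0 (c + 1) ∉ E := hc ▸ Nat.find_spec hex
  have hc0 : exponent q 0 c ∈ E := not_not.mp (Nat.find_min hex (by omega))
  rw [← card_degreeSimplex]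
  refine Finset.card_le_card_of_injOn (fun a => a + Finsupp.single 2 (c + 1)) ?_
    fun a _ b _ h => add_right_cancel h
  intro a ha
  rw [Finset.mem_coe, mem_degreeSimplex] at ha
  rw [Finset.mem_coe, Finset.mem_filter]
  constructor
  · have := hB.mem_of_degree_le hE hc0 (a := a + Finsupp.single 2 1) (by
      rw [map_add, Finsupp.degree_single]; omega)
    rwa [add_assoc, ← Finsupp.single_add, add_comm 1 c] at this
  · intro h
    refine hc1 (hE (exponent_le_iff.mpr ⟨?_, ?_, ?_⟩) h) <;> simp

/-- Nothing is lost in passing to `(w 0, (e 0, e 1, w 2))`: `w 1` is maximal for given `w 0`, `w 2`,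
and `e 2` is maximal for given `e 0`, `e 1`. The new triple is in `E` because `w 2 ≤ e 2`. -/
theorem card_socleColumnPairs_le (hE : IsLowerSet (E : Set (Fin 3 →₀ ℕ))) {m : ℕ}
    (hm : exponent m 0 0 ∉ E) :
    Nat.card (socleColumnPairs E) ≤
      {p ∈ Finset.range m ×ˢ E | exponent p.1 0 (p.2 2) ∈ E}.card := by
  classical
  rw [Nat.card_eq_fintype_card, ← Set.toFinset_card]
  refine Finset.card_le_card_of_injOn
    (fun p => (p.1.1 0, exponent (p.2.1 0) (p.2.1 1) (p.1.1 2))) ?_ ?_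
  · rintro ⟨w, e⟩ h
    rw [Finset.mem_coe, Set.mem_toFinset] at h
    rw [Finset.mem_coe, Finset.mem_filter, Finset.mem_product, Finset.mem_range]
    refine ⟨⟨?_, hE (exponent_le_iff.mpr ⟨?_, ?_, ?_⟩) e.2⟩,
      hE (exponent_le_iff.mpr ⟨?_, ?_, ?_⟩) w.2⟩
    · by_contra hlt
      exact hm (hE (exponent_le_iff.mpr ⟨by simpa using hlt, by simp, by simp⟩) w.2)
    all_goals simp
    exact h.2.2.2
  · rintro ⟨w, e⟩ h ⟨w', e'⟩ h' heq
    rw [Finset.mem_coe, Set.mem_toFinset] at h h'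
    simp only [Prod.mk.injEq] at heq
    obtain ⟨hw0, he⟩ := heq
    have he0 := DFunLike.congr_fun he 0
    have he1 := DFunLike.congr_fun he 1
    have hw2 := DFunLike.congr_fun he 2
    simp only [exponent_zero, exponent_one, exponent_two] at he0 he1 hw2
    have key1 : ∀ w w' : E, w.1 + Finsupp.single 1 1 ∉ E → w.1 0 = w'.1 0 → w.1 2 = w'.1 2 →
        w'.1 1 ≤ w.1 1 := fun w w' h h0 h2 => by
      by_contra hlt
      refine h (hE (exponent_le_iff.mpr ⟨?_, ?_, ?_⟩) w'.2) <;> simp <;> omega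
    have key2 : ∀ e e' : E, e.1 + Finsupp.single 2 1 ∉ E → e.1 0 = e'.1 0 → e.1 1 = e'.1 1 →
        e'.1 2 ≤ e.1 2 := fun w w' h h0 h2 => by
      by_contra hlt
      refine h (hE (exponent_le_iff.mpr ⟨?_, ?_, ?_⟩) w'.2) <;> simp <;> omega
    have hw1 := le_antisymm (key1 _ _ h'.2.1 hw0.symm hw2.symm) (key1 _ _ h.2.1 hw0 hw2)
    have he2 := le_antisymm (key2 _ _ h'.2.2.1 he0.symm he1.symm) (key2 _ _ h.2.2.1 he0 he1)
    exact Prod.ext (Subtype.ext (exponent_ext hw0 hw1 hw2)) (Subtype.ext (exponent_ext he0 he1 he2))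

theorem card_socleColumnPairs_add_le (hE : IsLowerSet (E : Set (Fin 3 →₀ ℕ)))
    (hB : IsBorelStable E) {m : ℕ} (hm : exponent m 0 0 ∉ E) (hm' : ∀ a < m, exponent a 0 0 ∈ E) :
    Nat.card (socleColumnPairs E) + ∑ q ∈ Finset.range m, (q + 2).choose 3 ≤ m * E.card := by
  classical
  have h1 := card_socleColumnPairs_le hE hm
  have h2 := Finset.card_filter_add_card_filter_not (s := Finset.range m ×ˢ E)
    (fun p => exponent p.1 0 (p.2 2) ∈ E)
  rw [Finset.card_product, Finset.card_range] at h2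
  have h3 : ∑ q ∈ Finset.range m, (q + 2).choose 3 ≤
      {p ∈ Finset.range m ×ˢ E | exponent p.1 0 (p.2 2) ∉ E}.card := by
    rw [Finset.card_filter, Finset.sum_product]
    refine Finset.sum_le_sum fun q hq => ?_
    rw [← Finset.card_filter]
    exact choose_le_card_filter hE hB (hm' q (Finset.mem_range.mp hq))
  omega

end borel

/-! ### Binomial identities and the numerical comparison. -/

section choose

theorem two_mul_choose_two (n : ℕ) : 2 * (n + 1).choose 2 = n * (n + 1) := by
  induction n with
  | zero => rfl
  | succ n ih => rw [Nat.choose_succ_succ' (n + 1) 1, mul_add, ih, Nat.choose_one_right]; ring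

theorem six_mul_choose_three (n : ℕ) : 6 * (n + 2).choose 3 = n * (n + 1) * (n + 2) := by
  induction n with
  | zero => rfl
  | succ n ih =>
    have := two_mul_choose_two (n + 1)
    rw [Nat.choose_succ_succ' (n + 2) 2]
    linarith

theorem sum_choose_three (n : ℕ) :
    24 * ∑ q ∈ Finset.range (n + 1), (q + 2).choose 3 = n * (n + 1) * (n + 2) * (n + 3) := by
  induction n with
  | zero => rfl
  | succ n ih =>
    have := six_mul_choose_three (n + 1)
    rw [Finset.sum_range_succ]
    linarith

/-- At `m = k` the upper bound equals the lower bound from the power of the maximal ideal exactly.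
-/
theorem choose_three_add_eq (k : ℕ) :
    (2 * k + 1) * (k + 2).choose 3 = (k + 2).choose 2 * (k + 1).choose 2 +
      2 * ∑ q ∈ Finset.range k, (q + 2).choose 3 := by
  rcases k with _ | k
  · rfl
  have h1 := two_mul_choose_two (k + 1)
  have h2 := two_mul_choose_two (k + 2)
  have h3 := six_mul_choose_three (k + 1)
  have h4 := sum_choose_three k
  have h5 := congrArg₂ (· * ·) h1 h2
  nlinarith

/-- Raising `m` to `m + 1` raises the bound on `a` by `C(k+2, 3) - C(m+2, 3)`, positive for `m < k`;
so the bound is strictly below its value at `k`. -/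
theorem choose_three_bound_lt {k m a : ℕ} (hmk : m < k)
    (ha : a + ∑ q ∈ Finset.range m, (q + 2).choose 3 ≤ m * (k + 2).choose 3) :
    (k + 2).choose 3 + 2 * a < (k + 2).choose 2 * (k + 1).choose 2 := by
  have h1 := choose_three_add_eq k
  have h2 : ∑ q ∈ Finset.Ico m k, (q + 2).choose 3 < ∑ q ∈ Finset.Ico m k, (k + 2).choose 3 := by
    refine Finset.sum_lt_sum_of_nonempty (Finset.nonempty_Ico.mpr hmk) fun q hq => ?_
    have h3 : (q + 2).choose 3 ≤ (k + 1).choose 3 :=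
      Nat.choose_le_choose 3 (by have := (Finset.mem_Ico.mp hq).2; omega)
    have h4 : 0 < (k + 1).choose 2 := Nat.choose_pos (by omega)
    have h5 : (k + 2).choose 3 = (k + 1).choose 2 + (k + 1).choose 3 :=
      Nat.choose_succ_succ' (k + 1) 2
    omega
  rw [Finset.sum_const, Nat.card_Ico, smul_eq_mul] at h2
  have h3 := Finset.sum_range_add_sum_Ico (fun q => (q + 2).choose 3) hmk.le
  obtain ⟨d, rfl⟩ := Nat.exists_eq_add_of_lt hmk
  rw [show m + d + 1 - m = d + 1 by omega] at h2
  nlinarith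

end choose

/-! ### Monomial ideals and their tangent spaces. -/

/-- `I` is the monomial ideal whose monomials are exactly those with exponent outside `E`. -/
def IsComplementIdeal {K : Type*} [Field K] (I : Ideal (R₃ K)) (E : Finset (Fin 3 →₀ ℕ)) : Prop :=
  ∀ f : R₃ K, f ∈ I ↔ ∀ e ∈ f.support, e ∉ E

section complement

variable {K : Type*} [Field K] {I : Ideal (R₃ K)} {E : Finset (Fin 3 →₀ ℕ)}

theorem IsComplementIdeal.monomial_mem_iff (hI : IsComplementIdeal I E) (a : Fin 3 →₀ ℕ) :
    monomial a (1 : K) ∈ I ↔ a ∉ E := by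
  classical
  rw [hI, support_monomial, if_neg one_ne_zero]
  simp

theorem IsComplementIdeal.isLowerSet (hI : IsComplementIdeal I E) :
    IsLowerSet (E : Set (Fin 3 →₀ ℕ)) := by
  intro b a hab hb
  by_contra ha
  rw [Finset.mem_coe, ← hI.monomial_mem_iff] at ha
  refine (hI.monomial_mem_iff b).mp ?_ hb
  rw [← tsub_add_cancel_of_le hab, ← one_mul (1 : K), ← monomial_mul]
  exact I.mul_mem_left _ ha

/-- Coordinates on the quotient by a monomial ideal. -/
noncomputable def IsComplementIdeal.coords (hI : IsComplementIdeal I E) :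
    (R₃ K ⧸ I) ≃ₗ[K] (E → K) :=
  have hker : I.restrictScalars K =
      LinearMap.ker (LinearMap.pi fun e : E => lcoeff K e.1 : R₃ K →ₗ[K] (E → K)) := by
    ext f
    rw [Submodule.restrictScalars_mem, hI, LinearMap.mem_ker]
    constructor
    · intro h
      ext e
      by_contra hne
      exact h e.1 (mem_support_iff.mpr hne) e.2
    · intro h e he heE
      exact mem_support_iff.mp he (congrFun h ⟨e, heE⟩)
  have hsurj : Function.Surjective
      (LinearMap.pi fun e : E => lcoeff K e.1 : R₃ K →ₗ[K] (E → K)) := by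
    intro v
    refine ⟨∑ e, monomial e.1 (v e), ?_⟩
    ext e
    simp [coeff_monomial]
  (Submodule.Quotient.restrictScalarsEquiv K I).symm ≪≫ₗ Submodule.quotEquivOfEq _ _ hker ≪≫ₗ
    LinearMap.quotKerEquivOfSurjective _ hsurj

theorem IsComplementIdeal.coords_mk (hI : IsComplementIdeal I E) (f : R₃ K) (e : E) :
    hI.coords (Ideal.Quotient.mk I f) e = coeff e.1 f := rfl

theorem IsComplementIdeal.coords_mk_monomial (hI : IsComplementIdeal I E) (a : Fin 3 →₀ ℕ)
    (c : K) : hI.coords (Ideal.Quotient.mk I (monomial a c)) = c • monomialClass K E a := by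
  ext e
  rw [hI.coords_mk, coeff_monomial, Pi.smul_apply, monomialClass, smul_eq_mul, mul_ite, mul_one,
    mul_zero]
  simp only [eq_comm]

theorem IsComplementIdeal.coords_X_smul (hI : IsComplementIdeal I E) (i : Fin 3)
    (q : R₃ K ⧸ I) :
    hI.coords ((X i : R₃ K) • q) = (shiftMatrix K E i).mulVec (hI.coords q) := by
  obtain ⟨f, rfl⟩ := Ideal.Quotient.mk_surjective q
  have h : ∀ f : R₃ K, (X i : R₃ K) • Ideal.Quotient.mk I f = Ideal.Quotient.mk I (X i * f) :=
    fun _ => rfl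
  induction f using MvPolynomial.induction_on' with
  | monomial a c =>
    rw [h, X, monomial_mul, one_mul, add_comm, hI.coords_mk_monomial, hI.coords_mk_monomial,
      Matrix.mulVec_smul, shiftMatrix_mulVec_monomialClass hI.isLowerSet]
  | add p q hp hq =>
    rw [map_add, smul_add, map_add, hp, hq, map_add, Matrix.mulVec_add]

theorem IsComplementIdeal.finite (hI : IsComplementIdeal I E) : Module.Finite K (R₃ K ⧸ I) :=
  Module.Finite.equiv hI.coords.symm

theorem IsComplementIdeal.finrank_eq (hI : IsComplementIdeal I E) :
    Module.finrank K (R₃ K ⧸ I) = E.card := by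
  rw [hI.coords.finrank_eq, Module.finrank_fintype_fun_eq_card, Fintype.card_coe]

theorem IsComplementIdeal.hom_ext (hI : IsComplementIdeal I E) {M : Type*} [AddCommGroup M]
    [Module (R₃ K) M] (φ : I →ₗ[R₃ K] M)
    (h : ∀ (a : Fin 3 →₀ ℕ) (ha : monomial a (1 : K) ∈ I), φ ⟨monomial a 1, ha⟩ = 0) : φ = 0 := by
  have hspan : I = Ideal.span ((fun a => monomial a (1 : K)) '' {a | monomial a (1 : K) ∈ I}) := by
    refine le_antisymm (fun f hf => ?_) (Ideal.span_le.mpr ?_)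
    · rw [mem_ideal_span_monomial_image]
      exact fun e he => ⟨e, (hI.monomial_mem_iff e).mpr ((hI f).mp hf e he), le_rfl⟩
    · rintro _ ⟨a, ha, rfl⟩
      exact ha
  have key : ∀ f (hf : f ∈ Ideal.span ((fun a => monomial a (1 : K)) ''
      {a | monomial a (1 : K) ∈ I})), φ ⟨f, hspan ▸ hf⟩ = 0 := by
    intro f hf
    induction hf using Submodule.span_induction with
    | mem x hx =>
      obtain ⟨a, ha, rfl⟩ := hx
      exact h a ha
    | zero => exact map_zero φ
    | add x y hx hy ihx ihy =>
      have := map_add φ ⟨x, hspan ▸ hx⟩ ⟨y, hspan ▸ hy⟩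
      rwa [ihx, ihy, add_zero] at this
    | smul r x hx ih =>
      have := map_smul φ r ⟨x, hspan ▸ hx⟩
      rwa [ih, smul_zero] at this
  ext f
  exact key f.1 (hspan ▸ f.2)

open Classical in
/-- A homomorphism on the ideal, together with arbitrary values on the monomials outside the
ideal other than `1`, as a linear map that is partially linear over the polynomial ring. -/
noncomputable def IsComplementIdeal.toPartialHom (hI : IsComplementIdeal I E) (h0 : 0 ∈ E) :
    ((I →ₗ[R₃ K] (R₃ K ⧸ I)) × ({e : E // e.1 ≠ 0} → E → K)) →ₗ[K] partialHoms K E where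
  toFun φ := ⟨fun a => if h : a ∈ E then (if h' : a ≠ 0 then φ.2 ⟨⟨a, h⟩, h'⟩ else 0) else
      hI.coords (φ.1 ⟨monomial a 1, (hI.monomial_mem_iff a).mpr h⟩), by simp [h0], fun a ha i => by
    have ha' : a + Finsupp.single i 1 ∉ E := fun h => ha (mem_of_add_single_mem hI.isLowerSet h)
    beta_reduce
    rw [dif_neg ha, dif_neg ha', ← hI.coords_X_smul, ← map_smul]
    congr 3
    show monomial (a + Finsupp.single i 1) (1 : K) = X i * monomial a 1
    rw [X, monomial_mul, one_mul, add_comm]⟩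
  map_add' φ χ := by
    ext a : 2
    by_cases h : a ∈ E
    · by_cases h' : a = 0
      · subst h'
        simp [h]
      · simp [h, h']
    · simp [h]
  map_smul' c φ := by
    ext a : 2
    by_cases h : a ∈ E
    · by_cases h' : a = 0
      · subst h'
        simp [h]
      · simp [h, h']
    · simp [h]

theorem IsComplementIdeal.toPartialHom_injective (hI : IsComplementIdeal I E) (h0 : 0 ∈ E) :
    Function.Injective (hI.toPartialHom h0) := by
  rw [injective_iff_map_eq_zero]
  rintro ⟨φ, u⟩ h
  have hval : ∀ a, (hI.toPartialHom h0 (φ, u)).1 a = 0 := fun a => by rw [h]; rfl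
  refine Prod.ext (hI.hom_ext φ fun a ha => ?_) ?_
  · have := hval a
    rw [hI.monomial_mem_iff] at ha
    simpa [IsComplementIdeal.toPartialHom, ha] using this
  · ext e : 1
    have := hval e.1.1
    simpa [IsComplementIdeal.toPartialHom, e.2] using this

theorem IsComplementIdeal.finite_hom (hI : IsComplementIdeal I E) (h0 : 0 ∈ E) :
    Module.Finite K (I →ₗ[R₃ K] (R₃ K ⧸ I)) :=
  Module.Finite.of_injective (hI.toPartialHom h0 ∘ₗ LinearMap.inl K _ _)
    ((hI.toPartialHom_injective h0).comp LinearMap.inl_injective)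

/-- An upper bound for the dimension of the tangent space at a Borel-fixed ideal. -/
theorem IsComplementIdeal.tangentDim_le (hI : IsComplementIdeal I E) (h0 : 0 ∈ E)
    (hB : IsBorelStable E) : tangentDim I ≤ E.card + 2 * Nat.card (socleColumnPairs E) := by
  classical
  have := hI.finite_hom h0
  have h1 := LinearMap.finrank_le_finrank_of_injective (hI.toPartialHom_injective h0)
  have h2 := finrank_partialHoms_le (K := K) hI.isLowerSet hB
  have h3 : Fintype.card {e : E // e.1 ≠ 0} + 1 = E.card := by
    have h := Fintype.card_subtype_compl (fun e : E => e = ⟨0, h0⟩)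
    have h' : ∀ e : E, ¬ e = ⟨0, h0⟩ ↔ e.1 ≠ 0 := fun e => not_congr Subtype.ext_iff
    simp only [h', Fintype.card_subtype_eq, Fintype.card_coe] at h
    have := Finset.card_pos.mpr ⟨0, h0⟩
    omega
  rw [Module.finrank_prod, Module.finrank_pi_fintype] at h1
  simp only [Module.finrank_fintype_fun_eq_card, Finset.sum_const, Finset.card_univ, smul_eq_mul,
    Fintype.card_coe] at h1
  rw [tangentDim]
  -- The free values on `E` without `0` account for all but `E.card` of the square in `h2`, which
  -- leaves the linear term.
  have h4 : E.card * E.card = Fintype.card {e : E // e.1 ≠ 0} * E.card + E.card := by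
    rw [← h3]; ring
  omega

end complement

/-! ### From Borel-fixed ideals to Borel-stable sets of exponents. -/

section borelFixed

variable {K : Type*} [Field K] {I : Ideal (R₃ K)}

theorem IsMonomialIdeal.mem_iff (hI : IsMonomialIdeal I) (f : R₃ K) :
    f ∈ I ↔ ∀ e ∈ f.support, monomial e (1 : K) ∈ I := by
  classical
  obtain ⟨S, rfl⟩ := hI
  rw [mem_ideal_span_monomial_image]
  refine forall₂_congr fun e _ => ?_
  rw [mem_ideal_span_monomial_image, support_monomial, if_neg one_ne_zero]
  simp

theorem finite_setOf_monomial_notMem [Module.Finite K (R₃ K ⧸ I)] (hI : IsMonomialIdeal I) :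
    {a | monomial a (1 : K) ∉ I}.Finite := by
  have hli : LinearIndependent K (fun a : {a | monomial a (1 : K) ∉ I} =>
      Ideal.Quotient.mkₐ K I (monomial a.1 1)) := by
    rw [linearIndependent_iff']
    intro s c hc a ha
    by_contra hne
    simp only [← map_smul, ← map_sum] at hc
    rw [Ideal.Quotient.mkₐ_eq_mk, Ideal.Quotient.eq_zero_iff_mem, hI.mem_iff] at hc
    refine a.2 (hc a.1 ?_)
    rw [mem_support_iff, coeff_sum, Finset.sum_eq_single a]
    · simpa using hne
    · intro b _ hb
      simp [coeff_monomial, Subtype.coe_ne_coe.mpr hb]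
    · exact fun h => absurd ha h
  exact hli.finite_of_isNoetherian

theorem IsBorelFixed.exists_isComplementIdeal [Module.Finite K (R₃ K ⧸ I)]
    (hI : IsBorelFixed I) : ∃ E, IsComplementIdeal I E ∧ IsBorelStable E := by
  set E := (finite_setOf_monomial_notMem hI.isMonomialIdeal).toFinset with hEdef
  have hmem : ∀ a, a ∈ E ↔ monomial a (1 : K) ∉ I := fun a => by simp [hEdef]
  have hE : IsComplementIdeal I E := fun f => by
    rw [hI.isMonomialIdeal.mem_iff]
    simp [hmem]
  refine ⟨E, hE, fun b i j hij hb => ?_⟩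
  by_contra hbj
  rw [← hE.monomial_mem_iff] at hbj
  obtain ⟨g, hg, hmin⟩ := exists_minimal_le_of_wellFoundedLT
    (fun a => monomial a (1 : K) ∈ I) _ hbj
  -- Either `g` uses the variable `x_j` and can be exchanged, or it already divides `b`; both put `b
  -- x_i` in the ideal.
  by_cases hgj : 1 ≤ g j
  · have h := hI.exchange g hmin i j hij hgj
    rw [hE.monomial_mem_iff] at h
    exact h (hE.isLowerSet (add_le_add_left (tsub_le_iff_right.mpr hg) _) hb)
  · have hgE := (hE.monomial_mem_iff g).mp hmin.prop
    refine hgE (hE.isLowerSet (fun k => ?_) hb)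
    have := hg k
    simp only [Finsupp.add_apply, Finsupp.single_apply] at this ⊢
    by_cases hk : j = k
    · subst hk; omega
    · simp only [hk, if_false] at this; omega

end borelFixed

/-! ### The tangent space at a power of the maximal ideal. -/

section fatPoint

/-- The `k`-th power of the maximal ideal at the origin, spanned by the monomials of degree at
least `k`. -/
noncomputable def fatPointIdeal (K : Type*) [Field K] (k : ℕ) : Ideal (R₃ K) :=
  Ideal.span ((fun g => monomial g (1 : K)) '' {g | k ≤ g.degree})

variable (K : Type*) [Field K] (k : ℕ)

theorem isComplementIdeal_fatPointIdeal :
    IsComplementIdeal (fatPointIdeal K k) (degreeSimplex k) := by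
  intro f
  rw [fatPointIdeal, mem_ideal_span_monomial_image]
  refine forall₂_congr fun e _ => ?_
  rw [mem_degreeSimplex, not_lt]
  exact ⟨fun ⟨g, hg, hge⟩ => le_trans hg (Finsupp.degree_mono hge), fun h => ⟨e, h, le_rfl⟩⟩

theorem isHilbPoint_fatPointIdeal : IsHilbPoint ((k + 2).choose 3) (fatPointIdeal K k) where
  finite := (isComplementIdeal_fatPointIdeal K k).finite
  colength := by rw [(isComplementIdeal_fatPointIdeal K k).finrank_eq, card_degreeSimplex]

variable {K k}

/-- A `K`-linear map that commutes with the variables is linear over the polynomial ring. -/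
noncomputable def linearMapOfCommutesX {M N : Type*} [AddCommGroup M] [Module K M] [Module (R₃ K) M]
    [IsScalarTower K (R₃ K) M] [AddCommGroup N] [Module K N] [Module (R₃ K) N]
    [IsScalarTower K (R₃ K) N] (φ : M →ₗ[K] N)
    (h : ∀ i m, φ ((X i : R₃ K) • m) = (X i : R₃ K) • φ m) : M →ₗ[R₃ K] N where
  toFun := φ
  map_add' := φ.map_add
  map_smul' r m := by
    rw [RingHom.id_apply]
    induction r using MvPolynomial.induction_on generalizing m with
    | C c =>
      have hc : (C c : R₃ K) = c • 1 := by rw [smul_eq_C_mul, mul_one]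
      rw [hc, smul_assoc, one_smul, map_smul, smul_assoc, one_smul]
    | add p q hp hq => rw [add_smul, map_add, hp, hq, add_smul]
    | mul_X p i hp => rw [mul_smul, hp, h, mul_smul]

/-- The homomorphisms from the `k`-th power of the maximal ideal which lower the degree by one. -/
noncomputable def fatPointHom (K : Type*) [Field K] (k : ℕ) :
    (degreeLayer k → degreeLayer (k - 1) → K) →ₗ[K]
      (fatPointIdeal K k →ₗ[R₃ K] (R₃ K ⧸ fatPointIdeal K k)) where
  toFun c := linearMapOfCommutesX
    { toFun := fun f => ∑ g, ∑ h, (c g h * coeff g.1 f.1) •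
        Ideal.Quotient.mk (fatPointIdeal K k) (monomial h.1 1)
      map_add' := fun f f' => by
        simp only [Submodule.coe_add, coeff_add, mul_add, add_smul, Finset.sum_add_distrib]
      map_smul' := fun a f => by
        simp only [RingHom.id_apply, Finset.smul_sum, smul_smul]
        refine Finset.sum_congr rfl fun g _ => Finset.sum_congr rfl fun h _ => ?_
        have : coeff g.1 (a • f).1 = a * coeff g.1 f.1 := coeff_smul g.1 a f.1
        rw [this, mul_left_comm] }
    (fun i f => by
      have hE := isComplementIdeal_fatPointIdeal K k
      -- Linearity holds because both sides vanish: `x_i f` has no term of degree `k`, and `x_i`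
      -- kills classes of degree `k - 1`.
      have h1 : ∀ g : degreeLayer k, coeff g.1 (X i * f.1) = 0 := fun g => by
        rw [coeff_X_mul']
        split_ifs with hg
        · by_contra hne
          have h2 := (hE f.1).mp f.2 _ (mem_support_iff.mpr hne)
          rw [mem_degreeSimplex, not_lt] at h2
          have h3 := mem_degreeLayer.mp g.2
          have h4 : g.1 - Finsupp.single i 1 + Finsupp.single i 1 = g.1 :=
            tsub_add_cancel_of_le (by
              rw [Finsupp.single_le_iff]
              exact Nat.one_le_iff_ne_zero.mpr (Finsupp.mem_support_iff.mp hg))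
          rw [← h4, map_add, Finsupp.degree_single] at h3
          omega
        · rfl
      have h2 : ∀ h : degreeLayer (k - 1), (X i : R₃ K) •
          Ideal.Quotient.mk (fatPointIdeal K k) (monomial h.1 1) = 0 := fun h => by
        refine Ideal.Quotient.eq_zero_iff_mem.mpr ?_
        show X i * monomial h.1 1 ∈ _
        rw [X, monomial_mul, one_mul, hE.monomial_mem_iff, mem_degreeSimplex, map_add,
          Finsupp.degree_single, mem_degreeLayer.mp h.2]
        omega
      have h3 : ((X i : R₃ K) • f).1 = X i * f.1 := rfl
      simp only [LinearMap.coe_mk, AddHom.coe_mk, h3, h1, mul_zero, zero_smul,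
        Finset.sum_const_zero, Finset.smul_sum]
      symm
      refine Finset.sum_eq_zero fun g _ => Finset.sum_eq_zero fun h _ => ?_
      rw [smul_comm, h2, smul_zero])
  map_add' c d := by
    ext f
    simp only [linearMapOfCommutesX, LinearMap.coe_mk, AddHom.coe_mk, Pi.add_apply, add_mul,
      add_smul, Finset.sum_add_distrib, LinearMap.add_apply]
  map_smul' a c := by
    ext f
    simp only [linearMapOfCommutesX, LinearMap.coe_mk, AddHom.coe_mk, Pi.smul_apply, smul_eq_mul,
      mul_assoc, mul_smul, LinearMap.smul_apply, RingHom.id_apply, Finset.smul_sum]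

theorem fatPointHom_injective (hk : 1 ≤ k) : Function.Injective (fatPointHom K k) := by
  classical
  rw [injective_iff_map_eq_zero]
  intro c hc
  have hE := isComplementIdeal_fatPointIdeal K k
  ext g h
  have hg : monomial g.1 (1 : K) ∈ fatPointIdeal K k := by
    rw [hE.monomial_mem_iff, mem_degreeSimplex, mem_degreeLayer.mp g.2]
    omega
  have hh : h.1 ∈ degreeSimplex k := by
    rw [mem_degreeSimplex, mem_degreeLayer.mp h.2]
    omega
  have h1 := congrFun (congrArg hE.coords (LinearMap.congr_fun hc ⟨_, hg⟩)) ⟨h.1, hh⟩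
  simpa [fatPointHom, linearMapOfCommutesX, hE.coords_mk_monomial, monomialClass, coeff_monomial,
    Subtype.coe_inj] using h1

theorem le_tangentDim_fatPointIdeal (hk : 1 ≤ k) :
    (k + 2).choose 2 * (k + 1).choose 2 ≤ tangentDim (fatPointIdeal K k) := by
  have h0 : (0 : Fin 3 →₀ ℕ) ∈ degreeSimplex k := by
    rw [mem_degreeSimplex, map_zero]
    omega
  have := (isComplementIdeal_fatPointIdeal K k).finite_hom h0
  have h1 := LinearMap.finrank_le_finrank_of_injective (fatPointHom_injective (K := K) hk)
  rw [Module.finrank_pi_fintype] at h1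
  rw [tangentDim]
  simpa only [Module.finrank_fintype_fun_eq_card, Finset.sum_const, Finset.card_univ, smul_eq_mul,
    Fintype.card_coe, card_degreeLayer, show k - 1 + 2 = k + 1 by omega] using h1

end fatPoint

/-! ### Conclusion. -/

theorem single_eq_exponent (m : ℕ) : Finsupp.single (0 : Fin 3) m = exponent m 0 0 :=
  exponent_ext (by simp) (by simp) (by simp)

theorem IsBorelStable.exponent_mem_of_single_mem {E : Finset (Fin 3 →₀ ℕ)}
    (hB : IsBorelStable E) {m : ℕ} (h : exponent m 0 0 ∈ E) (i : Fin 3) :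
    Finsupp.single i m ∈ E := by
  have hi : i = 0 ∨ i = 1 ∨ i = 2 := by decide +revert
  obtain rfl | rfl | rfl := hi
  · rwa [single_eq_exponent]
  · convert hB.exponent_one_mem m 0 0 0 (by simpa using h) using 1
    refine exponent_ext ?_ ?_ ?_ <;> simp
  · convert hB.exponent_two_mem m 0 0 0 (by simpa using h) using 1
    refine exponent_ext ?_ ?_ ?_ <;> simp

theorem corollary1p8 {K : Type*} [Field K] [CharZero K] (k : ℕ) (hk : 1 ≤ k)
    (I : Ideal (R₃ K)) (hB : IsBorelFixed I)
    (hI : HasMaximalSingularity (Nat.choose (k + 2) 3) I) :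
    IsPureExponent I 0 k ∧ IsLeast {m : ℕ | ∃ i : Fin 3, IsPureExponent I i m} k := by
  have := hI.isHilbPoint.finite
  obtain ⟨E, hE, hBE⟩ := hB.exists_isComplementIdeal
  have hlow := hE.isLowerSet
  have hcard : E.card = (k + 2).choose 3 := hE.finrank_eq.symm.trans hI.isHilbPoint.colength
  have hpos : 0 < E.card := hcard ▸ Nat.choose_pos (by omega)
  have h0 : (0 : Fin 3 →₀ ℕ) ∈ E := by
    obtain ⟨a, ha⟩ := Finset.card_pos.mp hpos
    exact hlow (show 0 ≤ a from zero_le) ha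
  -- Otherwise the least power of `x` in `I` is below `k`, and the two tangent bounds contradict
  -- maximality.
  have hk' : ∀ a < k, exponent a 0 0 ∈ E := by
    by_contra! hne
    classical
    obtain ⟨hlt, hm⟩ := Nat.find_spec hne
    set m := Nat.find hne
    have hm' : ∀ a < m, exponent a 0 0 ∈ E := fun a ha => by
      by_contra hna
      exact Nat.find_min hne ha ⟨ha.trans hlt, hna⟩
    have h1 := card_socleColumnPairs_add_le hlow hBE hm hm'
    rw [hcard] at h1
    have h2 := choose_three_bound_lt hlt h1
    have h3 := hE.tangentDim_le h0 hBE
    have h4 := le_tangentDim_fatPointIdeal (K := K) hk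
    have h5 := hI.tangentDim_le _ (isHilbPoint_fatPointIdeal K k)
    omega
  -- Otherwise `E` contains all `C(k+3, 3)` monomials of degree at most `k`, too many for the
  -- colength.
  have hkE : exponent k 0 0 ∉ E := fun h => by
    have h1 := Finset.card_le_card (degreeSimplex_subset hlow hBE (m := k + 1) fun a ha =>
      hlow (exponent_le_iff.mpr ⟨by simpa using Nat.lt_succ_iff.mp ha, by simp, by simp⟩) h)
    rw [card_degreeSimplex, hcard] at h1
    have h2 : (k + 1 + 2).choose 3 = (k + 2).choose 2 + (k + 2).choose 3 :=
      Nat.choose_succ_succ' (k + 2) 2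
    have h3 : 0 < (k + 2).choose 2 := Nat.choose_pos (by omega)
    omega
  have hle : ∀ i m, monomial (Finsupp.single i m) (1 : K) ∈ I → k ≤ m := fun i m h => by
    by_contra hlt
    exact (hE.monomial_mem_iff _).mp h (hBE.exponent_mem_of_single_mem (hk' m (by omega)) i)
  have hpure : IsPureExponent I 0 k := by
    refine ⟨(hE.monomial_mem_iff _).mpr (by rwa [single_eq_exponent]), fun a ha hak => ?_⟩
    have ha0 : a = Finsupp.single 0 (a 0) := by
      rw [single_eq_exponent] at hak ⊢
      have := exponent_le_iff.mp hak
      simp only [exponent_one, exponent_two] at this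
      refine exponent_ext ?_ ?_ ?_ <;> simp <;> omega
    rw [ha0] at ha ⊢
    exact Finsupp.single_le_single.mpr (hle 0 _ ha)
  exact ⟨hpure, ⟨0, hpure⟩, fun m ⟨i, hm⟩ => hle i m (Minimal.prop (P := fun a => monomial a (1 : K) ∈ I) hm)⟩
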